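/- Let $N\ge 2$, and let $\Omega_N=\{Z\in\mathbb C^{N\times N}: Z^*Z=ZZ^*\}$ be the set of normal $N\times N$ matrices. For $h>0$ let $\mu_h$ be the measure on $\Omega_N$ given by $$\int_{\Omega_N} f\,d\mu_h=(\pi h)^{-N}\int_{U(N)}\int_{\mathbb C^N} f(U^*DU)\,e^{-\|d\|^2/h}\,dd\,dU,\qquad D=\operatorname{diag}(d_1,\dots,d_N),$$ where $dU$ is the normalized Haar measure on $U(N)$ and $dd$ is Lebesgue measure on $\mathbb C^N$. Let $\mathcal H_h$ be the closed linear span in $L^2(\Omega_N,d\mu_h;\mathbb C^N)$ of the functions $Z\mapsto Z^k\chi$ ($k=0,1,2,\dots$, $\chi\in\mathbb C^N$); its reproducing kernel is $$K_h(X,Y)=\sum_{k=0}^\infty \frac{X^kY^{*k}}{k!\,h^k}.$$ Write $K_{X,\chi}(Y)=K_h(Y,X)\chi$; these functions belong to $\mathcal H_h$. For $\phi:\Omega_N\to\mathbb C^{N\times N}$ let $T_\phi f=P(\phi f)$ be the Toeplitz operator on $\mathcal H_h$ with domain $\{f\in\mathcal H_h:\phi f\in L^2\}$, where $P:L^2(\Omega_N,d\mu_h;\mathbb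 C^N)\to\mathcal H_h$ is the orthogonal projection. For an operator $T$ on $\mathcal H_h$ whose domain contains all $K_{X,\chi}$, let its Berezin transform be $$\widetilde T(X)=K_h(X,X)^{-1/2}\,W(X)\,K_h(X,X)^{-1/2},\qquad \chi'^*W(X)\chi=\langle TK_{X,\chi},K_{X,\chi'}\rangle\quad(\chi,\chi'\in\mathbb C^N).$$ Let $\phi(Z)=|\det Z|^2 I$ on $\Omega_N$. Then every $K_{X,\chi}$ lies in the domain of $T_\phi$, and for each $X\in\Omega_N$ $$\widetilde{T_\phi}(X)=h^{N-1}X^*X+h^N I+O(h^\infty)\qquad\text{as }h\searrow0,$$ that is, for every $M\ge0$ the difference of $\widetilde{T_\phi}(X)$ and $h^{N-1}X^*X+h^NI$ is $O(h^M)$ entrywise. Consequently $$\lim_{h\searrow0}\widetilde{T_\phi}(X)=0\qquad\text{for every }X\in\Omega_N .$$ Moreover $\phi\ne0$, and the property "$\widetilde{T_\phi}(X)\to\phi(X)$ as $h\searrow0$ for all $X\in\Omega_N$" fails. -/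

import Mathlib

open MeasureTheory Filter Topology Asymptotics

noncomputable section

namespace NormalBerezin

/-- Complex `N × N` matrices. -/
abbrev Mat (N : ℕ) := Matrix (Fin N) (Fin N) ℂ

/-- The space `ℂ^N` with its Euclidean norm. -/
abbrev CVec (N : ℕ) := EuclideanSpace ℂ (Fin N)

/-- The domain of all normal `N × N` matrices. -/
abbrev NormalMat (N : ℕ) := {Z : Mat N // Z.conjTranspose * Z = Z * Z.conjTranspose}

/-- The range of the semiclassical parameter: `h > 0`. -/
abbrev Planck := {h : ℝ // 0 < h}

/-- The filter `h ↘ 0` on the positive reals. -/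
def toZero : Filter Planck := comap Subtype.val (𝓝 (0 : ℝ))

instance (N : ℕ) : MeasurableSpace (NormalMat N) := borel _
instance (N : ℕ) : BorelSpace (NormalMat N) := ⟨rfl⟩
instance (N : ℕ) : MeasurableSpace (Matrix.unitaryGroup (Fin N) ℂ) := borel _
instance (N : ℕ) : BorelSpace (Matrix.unitaryGroup (Fin N) ℂ) := ⟨rfl⟩

/-- The unitary group is compact. -/
instance (N : ℕ) : CompactSpace (Matrix.unitaryGroup (Fin N) ℂ) := by
  refine @CompactSpace.mk _ _ (isCompact_iff_isCompact_univ.1 ?_)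
  change IsCompact ((Matrix.unitaryGroup (Fin N) ℂ : Submonoid (Mat N)) : Set (Mat N))
  have hc : IsClosed ((Matrix.unitaryGroup (Fin N) ℂ : Submonoid (Mat N)) : Set (Mat N)) := by
    have : ((Matrix.unitaryGroup (Fin N) ℂ : Submonoid (Mat N)) : Set (Mat N))
        = {A | A * star A = 1} := by
      ext A; exact Matrix.mem_unitaryGroup_iff
    rw [this]
    exact isClosed_eq (by fun_prop) continuous_const
  have hb : IsCompact {A : Mat N | ∀ i j, A i j ∈ Metric.closedBall (0 : ℂ) 1} := by
    have h1 : IsCompact (Set.pi Set.univ fun _ : Fin N =>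
        Set.pi Set.univ fun _ : Fin N => Metric.closedBall (0 : ℂ) 1) :=
      isCompact_univ_pi fun _ => isCompact_univ_pi fun _ => isCompact_closedBall _ _
    have h2 : {A : Mat N | ∀ i j, A i j ∈ Metric.closedBall (0 : ℂ) 1} =
        (Set.pi Set.univ fun _ : Fin N =>
          Set.pi Set.univ fun _ : Fin N => Metric.closedBall (0 : ℂ) 1) := by
      apply Set.ext
      intro A
      simp only [Set.mem_ofPred_eq]
      exact ⟨fun hA i _ j _ => hA i j, fun hA i j => hA i trivial j trivial⟩
    rw [h2]
    exact h1
  refine hb.of_isClosed_subset hc fun A hA i j => ?_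
  simpa using entry_norm_bound_of_unitary hA i j

/-- Normalized Haar measure on the unitary group. -/
def haarU (N : ℕ) : Measure (Matrix.unitaryGroup (Fin N) ℂ) := Measure.haarMeasure ⊤

/-- The Gaussian measure `(π h)^{-N} e^{-‖d‖²/h} dd` on `ℂ^N`. -/
def gaussC (N : ℕ) (h : Planck) : Measure (Fin N → ℂ) :=
  (volume : Measure (Fin N → ℂ)).withDensity fun d =>
    ENNReal.ofReal (((Real.pi * h) ^ N)⁻¹ * Real.exp (-(∑ i, ‖d i‖ ^ 2) / h))

/-- The map `(U, d) ↦ U* diag(d) U` into the normal matrices. -/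
def conjDiag (N : ℕ) (p : Matrix.unitaryGroup (Fin N) ℂ × (Fin N → ℂ)) : NormalMat N :=
  ⟨(p.1 : Mat N).conjTranspose * Matrix.diagonal p.2 * (p.1 : Mat N), by
    have hU : (p.1 : Mat N) * (p.1 : Mat N).conjTranspose = 1 :=
      Matrix.mem_unitaryGroup_iff.1 p.1.2
    have key : ∀ A B : Mat N,
        ((p.1 : Mat N).conjTranspose * A * (p.1 : Mat N)) *
          ((p.1 : Mat N).conjTranspose * B * (p.1 : Mat N)) =
        (p.1 : Mat N).conjTranspose * (A * B) * (p.1 : Mat N) := by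
      intro A B
      calc _ = (p.1 : Mat N).conjTranspose * A *
            ((p.1 : Mat N) * (p.1 : Mat N).conjTranspose) * B * (p.1 : Mat N) := by
            simp only [Matrix.mul_assoc]
        _ = _ := by rw [hU]; simp only [Matrix.mul_assoc, Matrix.mul_one]
    have hs : ((p.1 : Mat N).conjTranspose * Matrix.diagonal p.2 *
          (p.1 : Mat N)).conjTranspose =
        (p.1 : Mat N).conjTranspose * (Matrix.diagonal p.2).conjTranspose * (p.1 : Mat N) := by
      simp [Matrix.conjTranspose_mul, Matrix.mul_assoc]
    rw [hs, key, key, Matrix.diagonal_conjTranspose, Matrix.diagonal_mul_diagonal,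
      Matrix.diagonal_mul_diagonal]
    simp only [mul_comm]⟩

/-- The measure `μ_h` on the normal matrices:
`∫ f dμ_h = (π h)^{-N} ∫_{U(N)} ∫_{ℂ^N} f(U* D U) e^{-‖D‖²/h} dU dD`. -/
def mu (N : ℕ) (h : Planck) : Measure (NormalMat N) :=
  ((haarU N).prod (gaussC N h)).map (conjDiag N)

/-- The space `L²(Ω_N, dμ_h; ℂ^N)`. -/
abbrev L2 (N : ℕ) (h : Planck) := Lp (CVec N) 2 (mu N h)

/-- The space `ℋ_h`: the closed linear span in `L²` of the functions `Z ↦ Z^k χ`,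
`k = 0, 1, 2, …`, `χ ∈ ℂ^N`. -/
def Hspace (N : ℕ) (h : Planck) : Submodule ℂ (L2 N h) :=
  (Submodule.span ℂ {f : L2 N h | ∃ (k : ℕ) (χ : CVec N),
    (f : NormalMat N → CVec N) =ᵐ[mu N h]
      fun Z => WithLp.toLp 2 (((Z : Mat N) ^ k).mulVec χ)}).topologicalClosure

instance (N : ℕ) (h : Planck) : CompleteSpace (Hspace N h) :=
  (Submodule.isClosed_topologicalClosure _).completeSpace_coe

/-- The reproducing kernel `K_h(X, Y) = ∑_k X^k Y*^k / (k! h^k)`. -/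
def kernel (N : ℕ) (h : Planck) (X Y : Mat N) : Mat N :=
  ∑' k : ℕ, ((k.factorial : ℂ) * ((h : ℝ) : ℂ) ^ k)⁻¹ • (X ^ k * Y.conjTranspose ^ k)

/-- The function `K_{X,χ} : Y ↦ K_h(Y, X) χ`. -/
def kernelFun (N : ℕ) (h : Planck) (X : NormalMat N) (χ : CVec N) (Y : NormalMat N) : CVec N :=
  WithLp.toLp 2 ((kernel N h Y X).mulVec χ)

section
open scoped Matrix.Norms.L2Operator

theorem continuous_conjDiag (N : ℕ) : Continuous (conjDiag N) := by
  refine Continuous.subtype_mk ?_ _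
  fun_prop

theorem norm_conjDiag_le (N : ℕ) (p : Matrix.unitaryGroup (Fin N) ℂ × (Fin N → ℂ)) :
    ‖(conjDiag N p : Mat N)‖ ≤ ∑ i, ‖p.2 i‖ := by
  have h1 : ‖(conjDiag N p : Mat N)‖ = ‖(Matrix.diagonal p.2 : Mat N)‖ := by
    have h2 : (conjDiag N p : Mat N) =
        ((star p.1 : Matrix.unitaryGroup (Fin N) ℂ) : Mat N) * Matrix.diagonal p.2 *
          (p.1 : Mat N) := rfl
    rw [h2]
    exact (CStarRing.norm_mul_coe_unitary _ p.1).trans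
      (CStarRing.norm_coe_unitary_mul (star p.1) _)
  rw [h1, Matrix.l2_opNorm_diagonal]
  refine (pi_norm_le_iff_of_nonneg (Finset.sum_nonneg fun _ _ => norm_nonneg _)).2 fun i => ?_
  exact Finset.single_le_sum (f := fun i => ‖p.2 i‖) (fun _ _ => norm_nonneg _)
    (Finset.mem_univ i)

theorem integrable_exp_one (h : Planck) (B : ℝ) :
    Integrable (fun z : ℂ => Real.exp (-‖z‖ ^ 2 / h + B * ‖z‖)) := by
  have hh := h.2
  have h0 : Integrable (fun z : ℂ => Real.exp (-(1 / (2 * (h : ℝ))) * ‖z‖ ^ 2)) := by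
    have := (GaussianFourier.integrable_cexp_neg_mul_sq_norm_add (V := ℂ)
      (b := ((1 / (2 * (h : ℝ)) : ℝ) : ℂ)) (by rw [Complex.ofReal_re]; positivity) 0 0).norm
    refine this.congr (Eventually.of_forall fun z => ?_)
    simp [Complex.norm_exp, ← Complex.ofReal_pow]
  refine (h0.const_mul (Real.exp (B ^ 2 * h / 2))).mono' (by fun_prop)
    (Eventually.of_forall fun z => ?_)
  rw [Real.norm_of_nonneg (Real.exp_pos _).le, ← Real.exp_add]
  apply Real.exp_le_exp.2
  have : B ^ 2 * h / 2 + -(1 / (2 * (h : ℝ))) * ‖z‖ ^ 2 - (-‖z‖ ^ 2 / h + B * ‖z‖) =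
      (‖z‖ - B * h) ^ 2 / (2 * h) := by
    field_simp; ring
  have h2 : 0 ≤ (‖z‖ - B * h) ^ 2 / (2 * (h : ℝ)) := by positivity
  linarith

theorem integrable_exp_norm (N : ℕ) (h : Planck) (B : ℝ) (hB : 0 ≤ B) :
    Integrable (fun Y : NormalMat N => Real.exp (B * ‖(Y : Mat N)‖)) (mu N h) := by
  have : IsFiniteMeasure (haarU N) := by
    unfold haarU; exact ⟨(isCompact_univ).measure_lt_top⟩
  have hg : Integrable (fun d : Fin N → ℂ => Real.exp (B * ∑ i, ‖d i‖)) (gaussC N h) := by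
    unfold gaussC
    rw [integrable_withDensity_iff (by fun_prop) (by simp)]
    have h1 : Integrable (fun d : Fin N → ℂ =>
        ∏ i, Real.exp (-‖d i‖ ^ 2 / h + B * ‖d i‖)) :=
      Integrable.fintype_prod (f := fun _ z => Real.exp (-‖z‖ ^ 2 / h + B * ‖z‖))
        fun _ => integrable_exp_one h B
    refine (h1.const_mul (((Real.pi * h) ^ N)⁻¹)).congr (Eventually.of_forall fun d => ?_)
    have hh := h.2
    beta_reduce
    rw [ENNReal.toReal_ofReal (by positivity), ← Real.exp_sum, Finset.sum_add_distrib,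
      ← Finset.sum_div, Finset.sum_neg_distrib, ← Finset.mul_sum, Real.exp_add]
    ring
  have hc : Continuous (fun Y : NormalMat N => Real.exp (B * ‖(Y : Mat N)‖)) := by fun_prop
  unfold mu
  rw [integrable_map_measure hc.aestronglyMeasurable
    (continuous_conjDiag N).measurable.aemeasurable]
  have : SFinite (gaussC N h) := by unfold gaussC; infer_instance
  refine (hg.comp_snd (haarU N)).mono'
    (hc.comp (continuous_conjDiag N)).measurable.aestronglyMeasurable
    (Eventually.of_forall fun p => ?_)
  rw [Function.comp, Real.norm_of_nonneg (Real.exp_pos _).le]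
  exact Real.exp_le_exp.2 (mul_le_mul_of_nonneg_left (norm_conjDiag_le N p) hB)

/-- The `k`-th term of the series for `K_h(Y, X) χ`. -/
def kernelTerm (N : ℕ) (h : Planck) (X : NormalMat N) (χ : CVec N) (k : ℕ) (Y : NormalMat N) :
    CVec N :=
  WithLp.toLp 2 (((Y : Mat N) ^ k).mulVec
    (((k.factorial : ℂ) * ((h : ℝ) : ℂ) ^ k)⁻¹ •
      ((X : Mat N).conjTranspose ^ k).mulVec χ))

theorem norm_pow_le_l2 {N : ℕ} (A : Mat N) (k : ℕ) (v : CVec N) :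
    ‖(WithLp.toLp 2 ((A ^ k).mulVec v) : CVec N)‖ ≤ ‖A‖ ^ k * ‖v‖ := by
  induction k generalizing v with
  | zero => simp
  | succ k ih =>
    rw [pow_succ, ← Matrix.mulVec_mulVec]
    refine (ih (WithLp.toLp 2 (A.mulVec v))).trans ?_
    rw [pow_succ, mul_assoc]
    exact mul_le_mul_of_nonneg_left (Matrix.l2_opNorm_mulVec A v) (by positivity)

theorem norm_kernelTerm_le (N : ℕ) (h : Planck) (X : NormalMat N) (χ : CVec N) (k : ℕ)
    (Y : NormalMat N) :
    ‖kernelTerm N h X χ k Y‖ ≤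
      ‖χ‖ * ((‖(X : Mat N).conjTranspose‖ / h * ‖(Y : Mat N)‖) ^ k / k.factorial) := by
  have hh := h.2
  refine (norm_pow_le_l2 _ k (WithLp.toLp 2 (((k.factorial : ℂ) * ((h : ℝ) : ℂ) ^ k)⁻¹ •
      ((X : Mat N).conjTranspose ^ k).mulVec χ))).trans ?_
  rw [WithLp.toLp_smul, norm_smul]
  have h2 := norm_pow_le_l2 (X : Mat N).conjTranspose k χ
  have h3 : ‖((k.factorial : ℂ) * ((h : ℝ) : ℂ) ^ k)⁻¹‖ =
      ((k.factorial : ℝ) * (h : ℝ) ^ k)⁻¹ := by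
    simp [abs_of_pos hh]
  rw [h3]
  calc _ ≤ ‖(Y : Mat N)‖ ^ k * (((k.factorial : ℝ) * (h : ℝ) ^ k)⁻¹ *
        (‖(X : Mat N).conjTranspose‖ ^ k * ‖χ‖)) := by gcongr
    _ = _ := by rw [mul_pow, div_pow]; field_simp

theorem hasSum_kernelTerm (N : ℕ) (h : Planck) (X : NormalMat N) (χ : CVec N)
    (Y : NormalMat N) :
    HasSum (fun k => kernelTerm N h X χ k Y) (kernelFun N h X χ Y) := by
  have hh := h.2
  have hs : Summable fun k : ℕ => ((k.factorial : ℂ) * ((h : ℝ) : ℂ) ^ k)⁻¹ •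
      ((Y : Mat N) ^ k * (X : Mat N).conjTranspose ^ k) := by
    have hb : ∀ A : Mat N, ∀ k, ‖A ^ k‖ ≤ ‖(1 : Mat N)‖ * ‖A‖ ^ k := by
      intro A k
      induction k with
      | zero => simp
      | succ k ih =>
        rw [pow_succ, pow_succ, ← mul_assoc]
        exact (norm_mul_le _ _).trans (mul_le_mul_of_nonneg_right ih (norm_nonneg _))
    refine Summable.of_norm_bounded
      (g := fun k => (‖(1 : Mat N)‖ * ‖(1 : Mat N)‖) *
        ((‖(X : Mat N).conjTranspose‖ / h * ‖(Y : Mat N)‖) ^ k / k.factorial))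
      ((Real.summable_pow_div_factorial _).mul_left _) fun k => ?_
    rw [norm_smul]
    have h3 : ‖((k.factorial : ℂ) * ((h : ℝ) : ℂ) ^ k)⁻¹‖ =
        ((k.factorial : ℝ) * (h : ℝ) ^ k)⁻¹ := by
      simp [abs_of_pos hh]
    rw [h3]
    calc _ ≤ ((k.factorial : ℝ) * (h : ℝ) ^ k)⁻¹ * ((‖(1 : Mat N)‖ * ‖(Y : Mat N)‖ ^ k) *
          (‖(1 : Mat N)‖ * ‖(X : Mat N).conjTranspose‖ ^ k)) := by
          refine mul_le_mul_of_nonneg_left ((norm_mul_le _ _).trans ?_) (by positivity)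
          exact mul_le_mul (hb _ _) (hb _ _) (norm_nonneg _) (by positivity)
      _ = _ := by rw [mul_pow, div_pow]; field_simp
  let L : Mat N →+ CVec N :=
    { toFun := fun A => WithLp.toLp 2 (A.mulVec χ)
      map_zero' := by simp
      map_add' := fun A B => by simp [Matrix.add_mulVec] }
  have hL : Continuous L := by
    change Continuous fun A : Mat N => (WithLp.toLp 2 (A.mulVec χ) : CVec N)
    fun_prop
  have := hs.hasSum.map L hL
  suffices he : (fun k => kernelTerm N h X χ k Y) = L ∘ fun k : ℕ =>
      ((k.factorial : ℂ) * ((h : ℝ) : ℂ) ^ k)⁻¹ •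
        ((Y : Mat N) ^ k * (X : Mat N).conjTranspose ^ k) by
    rw [he]
    exact this
  funext k
  change kernelTerm N h X χ k Y = WithLp.toLp 2 (Matrix.mulVec _ _)
  rw [Matrix.smul_mulVec, ← Matrix.mulVec_mulVec, kernelTerm, Matrix.mulVec_smul]

theorem continuous_kernelTerm (N : ℕ) (h : Planck) (X : NormalMat N) (χ : CVec N) (k : ℕ) :
    Continuous (kernelTerm N h X χ k) := by
  unfold kernelTerm
  fun_prop

/-- The dominating function for the kernel series. -/
def kernelBound (N : ℕ) (h : Planck) (X : NormalMat N) (χ : CVec N) (Y : NormalMat N) : ℝ :=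
  ‖χ‖ * Real.exp (‖(X : Mat N).conjTranspose‖ / h * ‖(Y : Mat N)‖)

theorem norm_partial_le (N : ℕ) (h : Planck) (X : NormalMat N) (χ : CVec N) (n : ℕ)
    (Y : NormalMat N) :
    ‖∑ k ∈ Finset.range n, kernelTerm N h X χ k Y‖ ≤ kernelBound N h X χ Y := by
  have hh := h.2
  refine (norm_sum_le _ _).trans ((Finset.sum_le_sum fun k _ =>
    norm_kernelTerm_le N h X χ k Y).trans ?_)
  rw [← Finset.mul_sum]
  exact mul_le_mul_of_nonneg_left (Real.sum_le_exp_of_nonneg (by positivity) n) (norm_nonneg _)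

theorem norm_kernelFun_le (N : ℕ) (h : Planck) (X : NormalMat N) (χ : CVec N)
    (Y : NormalMat N) : ‖kernelFun N h X χ Y‖ ≤ kernelBound N h X χ Y :=
  le_of_tendsto (hasSum_kernelTerm N h X χ Y).tendsto_sum_nat.norm
    (Eventually.of_forall fun n => norm_partial_le N h X χ n Y)

theorem memLp_kernelBound (N : ℕ) (h : Planck) (X : NormalMat N) (χ : CVec N) :
    MemLp (kernelBound N h X χ) 2 (mu N h) := by
  have hh := h.2
  have hc : Continuous (kernelBound N h X χ) := by unfold kernelBound; fun_prop
  rw [memLp_two_iff_integrable_sq hc.aestronglyMeasurable]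
  refine ((integrable_exp_norm N h (2 * (‖(X : Mat N).conjTranspose‖ / h))
    (by positivity)).const_mul (‖χ‖ ^ 2)).congr (Eventually.of_forall fun Y => ?_)
  simp only [kernelBound, mul_pow, ← Real.exp_nat_mul]
  congr 2
  push_cast
  ring

theorem aesm_kernelFun (N : ℕ) (h : Planck) (X : NormalMat N) (χ : CVec N) :
    AEStronglyMeasurable (kernelFun N h X χ) (mu N h) :=
  aestronglyMeasurable_of_tendsto_ae (u := atTop)
    (f := fun n Y => ∑ k ∈ Finset.range n, kernelTerm N h X χ k Y)
    (fun _ => (continuous_finsetSum _ fun k _ =>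
      continuous_kernelTerm N h X χ k).aestronglyMeasurable)
    (Eventually.of_forall fun Y => (hasSum_kernelTerm N h X χ Y).tendsto_sum_nat)

theorem memLp_kernelFun (N : ℕ) (h : Planck) (X : NormalMat N) (χ : CVec N) :
    MemLp (kernelFun N h X χ) 2 (mu N h) :=
  (memLp_kernelBound N h X χ).mono' (aesm_kernelFun N h X χ)
    (Eventually.of_forall fun Y => norm_kernelFun_le N h X χ Y)

theorem memLp_kernelTerm (N : ℕ) (h : Planck) (X : NormalMat N) (χ : CVec N) (k : ℕ) :
    MemLp (kernelTerm N h X χ k) 2 (mu N h) := by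
  have hh := h.2
  refine (memLp_kernelBound N h X χ).mono'
    (continuous_kernelTerm N h X χ k).aestronglyMeasurable
    (Eventually.of_forall fun Y => (norm_kernelTerm_le N h X χ k Y).trans ?_)
  exact mul_le_mul_of_nonneg_left (Real.pow_div_factorial_le_exp _ (by positivity) k)
    (norm_nonneg _)

theorem memLp_partial (N : ℕ) (h : Planck) (X : NormalMat N) (χ : CVec N) (n : ℕ) :
    MemLp (fun Y => ∑ k ∈ Finset.range n, kernelTerm N h X χ k Y) 2 (mu N h) :=
  memLp_finsetSum _ fun k _ => memLp_kernelTerm N h X χ k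

theorem partial_mem (N : ℕ) (h : Planck) (X : NormalMat N) (χ : CVec N) (n : ℕ) :
    (memLp_partial N h X χ n).toLp ∈ Hspace N h := by
  have : (memLp_partial N h X χ n).toLp =
      ∑ k ∈ Finset.range n, (memLp_kernelTerm N h X χ k).toLp := by
    induction n with
    | zero =>
      rw [Finset.sum_range_zero, ← MemLp.toLp_zero (MemLp.zero (ε := CVec N))]
      exact MemLp.toLp_congr _ _ (Eventually.of_forall fun Y => by simp)
    | succ n ih =>
      rw [Finset.sum_range_succ, ← ih, ← MemLp.toLp_add]
      exact MemLp.toLp_congr _ _ (Eventually.of_forall fun Y => by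
        simp [Finset.sum_range_succ])
  rw [this]
  refine Submodule.sum_mem _ fun k _ => Submodule.le_topologicalClosure _
    (Submodule.subset_span ⟨k, WithLp.toLp 2 (((k.factorial : ℂ) * ((h : ℝ) : ℂ) ^ k)⁻¹ •
      ((X : Mat N).conjTranspose ^ k).mulVec χ), ?_⟩)
  exact MemLp.coeFn_toLp _

theorem kernelFun_mem (N : ℕ) (h : Planck) (X : NormalMat N) (χ : CVec N) :
    (memLp_kernelFun N h X χ).toLp ∈ Hspace N h := by
  refine (Submodule.isClosed_topologicalClosure _).mem_of_tendsto
    (f := fun n => (memLp_partial N h X χ n).toLp) (b := atTop) ?_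
    (Eventually.of_forall fun n => partial_mem N h X χ n)
  rw [Lp.tendsto_Lp_iff_tendsto_eLpNorm'']
  have hb := memLp_kernelBound N h X χ
  have hint : ∫⁻ Y, ENNReal.ofReal ((2 * kernelBound N h X χ Y) ^ 2) ∂(mu N h) ≠ ⊤ :=
    ((hb.const_mul 2).integrable_sq.lintegral_lt_top).ne
  have key : Tendsto (fun n => ∫⁻ Y, ‖(∑ k ∈ Finset.range n, kernelTerm N h X χ k Y) -
      kernelFun N h X χ Y‖ₑ ^ (2 : ℝ) ∂(mu N h)) atTop (𝓝 (∫⁻ _, 0 ∂(mu N h))) := by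
    refine tendsto_lintegral_of_dominated_convergence' _ (fun n => ?_) (fun n => ?_) hint ?_
    · exact ((memLp_partial N h X χ n).1.sub (aesm_kernelFun N h X χ)).enorm.pow_const _
    · refine Eventually.of_forall fun Y => ?_
      beta_reduce
      rw [ENNReal.rpow_two, ← ofReal_norm, ← ENNReal.ofReal_pow (norm_nonneg _)]
      refine ENNReal.ofReal_le_ofReal (pow_le_pow_left₀ (norm_nonneg _) ?_ 2)
      refine (norm_sub_le _ _).trans ?_
      linarith [norm_partial_le N h X χ n Y, norm_kernelFun_le N h X χ Y]
    · refine Eventually.of_forall fun Y => ?_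
      have h1 := ((hasSum_kernelTerm N h X χ Y).tendsto_sum_nat.sub_const
        (kernelFun N h X χ Y)).enorm
      have h2 := (ENNReal.continuous_rpow_const (y := 2)).tendsto _ |>.comp h1
      simpa [Function.comp_def] using h2
  rw [lintegral_zero] at key
  have h3 := (ENNReal.continuous_rpow_const (y := 1 / 2)).tendsto 0 |>.comp key
  simp only [Function.comp_def] at h3
  rw [ENNReal.zero_rpow_of_pos (by norm_num)] at h3
  refine h3.congr fun n => ?_
  rw [eLpNorm_eq_lintegral_rpow_enorm_toReal (by norm_num) (by norm_num)]
  simp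

end

/-- `K_{X,χ}` as an element of `ℋ_h`. -/
def kernelVec (N : ℕ) (h : Planck) (X : NormalMat N) (χ : CVec N) : Hspace N h :=
  ⟨(memLp_kernelFun N h X χ).toLp, kernelFun_mem N h X χ⟩

/-- The product of a matrix-valued symbol and a vector-valued function. -/
def symMul {N : ℕ} (φ : NormalMat N → Mat N) (f : NormalMat N → CVec N) :
    NormalMat N → CVec N :=
  fun Y => WithLp.toLp 2 ((φ Y).mulVec (f Y))

theorem symMul_add {N : ℕ} {h : Planck} (φ : NormalMat N → Mat N) (f g : L2 N h) :
    symMul φ ⇑(f + g) =ᵐ[mu N h] symMul φ ⇑f + symMul φ ⇑g := by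
  filter_upwards [Lp.coeFn_add f g] with Y hY
  rw [Pi.add_apply, symMul, hY, Pi.add_apply, WithLp.ofLp_add, Matrix.mulVec_add,
    WithLp.toLp_add]
  rfl

theorem symMul_smul {N : ℕ} {h : Planck} (φ : NormalMat N → Mat N) (c : ℂ) (f : L2 N h) :
    symMul φ ⇑(c • f) =ᵐ[mu N h] c • symMul φ ⇑f := by
  filter_upwards [Lp.coeFn_smul c f] with Y hY
  rw [Pi.smul_apply, symMul, hY, Pi.smul_apply, WithLp.ofLp_smul, Matrix.mulVec_smul,
    WithLp.toLp_smul]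
  rfl

theorem symMul_zero {N : ℕ} {h : Planck} (φ : NormalMat N → Mat N) :
    symMul φ ⇑(0 : L2 N h) =ᵐ[mu N h] 0 := by
  filter_upwards [Lp.coeFn_zero (CVec N) 2 (mu N h)] with Y hY
  rw [symMul, hY, Pi.zero_apply, WithLp.ofLp_zero, Matrix.mulVec_zero,
    WithLp.toLp_zero]

/-- The maximal domain `{f ∈ ℋ_h | φ f ∈ L²}` of the Toeplitz operator `T_φ` (all of `ℋ_h` if
`φ` is bounded). -/
def toeplitzDomain (N : ℕ) (h : Planck) (φ : NormalMat N → Mat N) :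
    Submodule ℂ (Hspace N h) where
  carrier := {f | MemLp (symMul φ ⇑(f : L2 N h)) 2 (mu N h)}
  add_mem' := fun {f g} hf hg =>
    (memLp_congr_ae (symMul_add φ (f : L2 N h) (g : L2 N h))).2 (MemLp.add hf hg)
  zero_mem' := (memLp_congr_ae (symMul_zero φ)).2 MemLp.zero
  smul_mem' := fun c f hf =>
    (memLp_congr_ae (symMul_smul φ c (f : L2 N h))).2 (MemLp.const_smul hf c)

theorem memLp_symMul {N : ℕ} {h : Planck} {φ : NormalMat N → Mat N}
    (f : toeplitzDomain N h φ) :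
    MemLp (symMul φ ⇑((f : Hspace N h) : L2 N h)) 2 (mu N h) := f.2

/-- Multiplication by `φ` as a map into `L²`. -/
def mulSymbol (N : ℕ) (h : Planck) (φ : NormalMat N → Mat N) :
    toeplitzDomain N h φ →ₗ[ℂ] L2 N h where
  toFun f := (memLp_symMul f).toLp
  map_add' f g := by
    rw [← MemLp.toLp_add]
    exact MemLp.toLp_congr _ _ (symMul_add φ _ _)
  map_smul' c f := by
    rw [RingHom.id_apply, ← MemLp.toLp_const_smul]
    exact MemLp.toLp_congr _ _ (symMul_smul φ c _)

/-- The Toeplitz operator `T_φ f = P(φ f)` on `ℋ_h`, where `P : L² → ℋ_h` is the orthogonal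
projection. -/
def toeplitz (N : ℕ) (h : Planck) (φ : NormalMat N → Mat N) :
    Hspace N h →ₗ.[ℂ] Hspace N h where
  domain := toeplitzDomain N h φ
  toFun := (Hspace N h).orthogonalProjectionOnto.toLinearMap ∘ₗ mulSymbol N h φ

section
open scoped MatrixOrder

/-- The Berezin transform `K(X,X)^{-1/2} W(X) K(X,X)^{-1/2}` of an operator `T` on `ℋ_h`
whose domain contains all `K_{X,χ}`, where `W(X)` is the matrix with
`χ'* W(X) χ = ⟨T K_{X,χ}, K_{X,χ'}⟩`. (Mathlib's inner product is linear in its second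
argument.) -/
def berezin {N : ℕ} {h : Planck} (T : Hspace N h →ₗ.[ℂ] Hspace N h)
    (hT : ∀ X χ, kernelVec N h X χ ∈ T.domain) (X : NormalMat N) : Mat N :=
  kernel N h X X ^ (-1 / 2 : ℝ) *
    Matrix.of (fun a b : Fin N =>
      inner ℂ (kernelVec N h X (EuclideanSpace.single a 1))
        (T ⟨kernelVec N h X (EuclideanSpace.single b 1), hT X _⟩)) *
    kernel N h X X ^ (-1 / 2 : ℝ)

end

/-- The symbol `φ(Z) = |det Z|² I`. -/
def detSymbol (N : ℕ) : NormalMat N → Mat N :=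
  fun Z => ((‖(Z : Mat N).det‖ ^ 2 : ℝ) : ℂ) • (1 : Mat N)

end NormalBerezin

end

noncomputable section

namespace NormalBerezin
open scoped ComplexConjugate

/-! The asymptotic expansion is an identity: for every $h>0$ the Berezin transform equals
$h^{N-1}X^*X+h^NI$ exactly, so the $O(h^\infty)$ remainder is zero.

In the coordinates $Z=U^*DU$ the weight $|\det Z|^2=\prod_i|d_i|^2$ depends on $D$ alone, and
$\langle Z^kv,Z^lw\rangle=\sum_j\bar d_j^k d_j^l\,\overline{(Uv)_j}(Uw)_j$. The Gaussian moment of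
$|\det Z|^2\bar d_j^kd_j^l$ is $\delta_{kl}h^{N+k}(k+1)!$, the same for every $j$. Hence the sum
over $j$ collapses to $\langle v,w\rangle$ and the Haar integral is trivial
(`integral_det_inner_pow`).

Inserting the kernel series twice leaves only its diagonal. With $A=XX^*/h$, normality gives
$K_h(X,X)=e^A$ and $W(X)=h^N\sum_k\frac{k+1}{k!}A^k=h^N(1+A)e^A$ (`berezin_weight`). All factors are
functions of $A$, so conjugation by $K_h(X,X)^{-1/2}$ leaves $h^N(1+A)$
(`berezin_toeplitz_detSymbol`). For $N\ge2$ both terms vanish as $h\searrow0$, whereas $\phi(I)=I$.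
-/

/-! ### Gaussian moments on $\mathbb C$ and $\mathbb C^N$ -/

theorem integral_normSq_pow_gaussian (h : Planck) (k : ℕ) :
    ∫ z : ℂ, ‖z‖ ^ (2 * k) * Real.exp (-‖z‖ ^ 2 / h) =
      Real.pi * (h : ℝ) ^ (k + 1) * k.factorial := by
  have hh := h.2
  -- The factorial arises as $\Gamma((2k+2)/2)=k!$.
  have := Complex.integral_rpow_mul_exp_neg_mul_rpow (p := 2) (q := 2 * k) (b := (h : ℝ)⁻¹)
    (by norm_num) (by have : (0 : ℝ) ≤ k := k.cast_nonneg; linarith) (by positivity)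
  have e1 : ((2 : ℝ) * k + 2) / 2 = (k : ℝ) + 1 := by ring
  rw [neg_div, e1, Real.Gamma_nat_eq_factorial, Real.inv_rpow hh.le, Real.rpow_neg hh.le,
    inv_inv, ← Nat.cast_add_one, Real.rpow_natCast] at this
  convert this using 1
  · congr 1
    funext z
    rw [show (2 : ℝ) * k = ((2 * k : ℕ) : ℝ) by push_cast; ring, Real.rpow_natCast]
    congr 2
    rw [Real.rpow_two]
    ring
  · ring

/-- Rotation by the angle $\pi/(l-k)$ preserves Lebesgue measure and $|z|$ but multiplies $\bar
z^kz^l$ by $e^{i\pi}=-1$, so the integral equals its own negative. -/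
theorem integral_gaussian_eq_zero_of_ne (h : Planck) {k l : ℕ} (hkl : k ≠ l) :
    ∫ z : ℂ, conj z ^ k * z ^ l * (Real.exp (-‖z‖ ^ 2 / h) : ℂ) = 0 := by
  set t : ℝ := Real.pi / ((l : ℝ) - k) with ht
  have hd : (l : ℝ) - k ≠ 0 := sub_ne_zero.2 (by exact_mod_cast hkl.symm)
  have hu : conj (Circle.exp t : ℂ) ^ k * (Circle.exp t : ℂ) ^ l = -1 := by
    rw [Circle.coe_exp, ← Complex.exp_conj, ← Complex.exp_nat_mul, ← Complex.exp_nat_mul,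
      ← Complex.exp_add, ← Complex.exp_pi_mul_I]
    congr 1
    have : (t : ℂ) * ((l : ℂ) - k) = Real.pi := by
      rw [ht]
      have hd' : (l : ℂ) - k ≠ 0 := by exact_mod_cast hd
      push_cast
      field_simp
    simp only [map_mul, Complex.conj_ofReal, Complex.conj_I]
    linear_combination Complex.I * this
  have hr := (rotation (Circle.exp t)).measurePreserving.integral_comp
    (rotation (Circle.exp t)).toHomeomorph.measurableEmbedding
    (fun z : ℂ => conj z ^ k * z ^ l * (Real.exp (-‖z‖ ^ 2 / h) : ℂ))
  have h2 : ∀ z : ℂ, conj (rotation (Circle.exp t) z) ^ k * (rotation (Circle.exp t) z) ^ l *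
      (Real.exp (-‖rotation (Circle.exp t) z‖ ^ 2 / h) : ℂ) =
      -(conj z ^ k * z ^ l * (Real.exp (-‖z‖ ^ 2 / h) : ℂ)) := by
    intro z
    rw [LinearIsometryEquiv.norm_map, rotation_apply, map_mul, mul_pow, mul_pow]
    linear_combination (conj z ^ k * z ^ l * (Real.exp (-‖z‖ ^ 2 / h) : ℂ)) * hu
  simp only [h2, integral_neg] at hr
  exact self_eq_neg.1 hr.symm

theorem integral_conj_pow_mul_pow_gaussian (h : Planck) (k l : ℕ) :
    ∫ z : ℂ, conj z ^ k * z ^ l * (Real.exp (-‖z‖ ^ 2 / h) : ℂ) =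
      if k = l then ((Real.pi * (h : ℝ) ^ (k + 1) * k.factorial : ℝ) : ℂ) else 0 := by
  split_ifs with hkl
  · subst hkl
    rw [← integral_normSq_pow_gaussian, ← integral_complex_ofReal]
    congr 1
    funext z
    rw [← mul_pow, Complex.conj_mul', ← pow_mul]
    push_cast
    rfl
  · exact integral_gaussian_eq_zero_of_ne h hkl

/-- Splits $(\pi h)^{-N}$ and the exponential evenly over the coordinates, so that integrals against
`gaussC` factor into one-dimensional ones. -/
theorem density_smul_prod (N : ℕ) (h : Planck) (f : Fin N → ℂ → ℂ) (d : Fin N → ℂ) :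
    (ENNReal.ofReal (((Real.pi * (h : ℝ)) ^ N)⁻¹ *
      Real.exp (-(∑ i, ‖d i‖ ^ 2) / h))).toReal • ∏ i, f i (d i) =
      ∏ i, (((Real.pi * (h : ℝ) : ℝ) : ℂ)⁻¹ *
        (f i (d i) * (Real.exp (-‖d i‖ ^ 2 / h) : ℂ))) := by
  have hh := h.2
  rw [ENNReal.toReal_ofReal (by positivity), Finset.prod_mul_distrib, Finset.prod_const,
    Finset.prod_mul_distrib, Finset.card_univ, Fintype.card_fin, ← Complex.ofReal_prod,
    ← Real.exp_sum, ← Finset.sum_div, Finset.sum_neg_distrib, Complex.real_smul]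
  push_cast
  rw [inv_pow]
  ring

theorem integrable_conj_pow_mul_pow_gaussian (h : Planck) (k l : ℕ) :
    Integrable fun z : ℂ => conj z ^ k * z ^ l * (Real.exp (-‖z‖ ^ 2 / h) : ℂ) := by
  refine ((integrable_exp_one h 1).const_mul ((k + l).factorial : ℝ)).mono'
    (Continuous.aestronglyMeasurable (by fun_prop)) (Eventually.of_forall fun z => ?_)
  -- The monomial is absorbed by $|z|^{k+l}\le(k+l)!\,e^{|z|}$, which accounts for the linear
  -- coefficient 1 in the dominating function.
  have h1 := Real.pow_div_factorial_le_exp ‖z‖ (norm_nonneg _) (k + l)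
  rw [div_le_iff₀ (by positivity)] at h1
  rw [norm_mul, norm_mul, norm_pow, norm_pow, RCLike.norm_conj, ← pow_add, Complex.norm_real,
    Real.norm_of_nonneg (Real.exp_pos _).le, one_mul, Real.exp_add]
  calc _ ≤ (Real.exp ‖z‖ * (k + l).factorial) * Real.exp (-‖z‖ ^ 2 / h) := by gcongr
    _ = _ := by ring

theorem integrable_monomial_gaussC (N : ℕ) (h : Planck) (α β : Fin N → ℕ) :
    Integrable (fun d => ∏ i, (conj (d i) ^ α i * d i ^ β i)) (gaussC N h) := by
  unfold gaussC
  rw [integrable_withDensity_iff_integrable_smul' (by fun_prop) (by simp)]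
  simp only [density_smul_prod N h (fun i z => conj z ^ α i * z ^ β i)]
  exact Integrable.fintype_prod (f := fun i z => ((Real.pi * (h : ℝ) : ℝ) : ℂ)⁻¹ *
    (conj z ^ α i * z ^ β i * (Real.exp (-‖z‖ ^ 2 / h) : ℂ)))
    fun i => (integrable_conj_pow_mul_pow_gaussian h _ _).const_mul _

theorem integral_monomial_gaussC (N : ℕ) (h : Planck) (α β : Fin N → ℕ) :
    ∫ d, ∏ i, (conj (d i) ^ α i * d i ^ β i) ∂(gaussC N h) =
      ∏ i, if α i = β i then ((h : ℝ) : ℂ) ^ α i * (α i).factorial else 0 := by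
  have hh := h.2
  unfold gaussC
  rw [integral_withDensity_eq_integral_toReal_smul (by fun_prop) (by simp)]
  simp only [density_smul_prod N h (fun i z => conj z ^ α i * z ^ β i)]
  rw [integral_fintype_prod_volume_eq_prod (E := fun _ : Fin N => ℂ) (fun i z =>
    ((Real.pi * (h : ℝ) : ℝ) : ℂ)⁻¹ *
        (conj z ^ α i * z ^ β i * (Real.exp (-‖z‖ ^ 2 / h) : ℂ)))]
  refine Finset.prod_congr rfl fun i _ => ?_
  rw [integral_const_mul, integral_conj_pow_mul_pow_gaussian]
  split_ifs
  · have h1 : ((h : ℝ) : ℂ) ≠ 0 := by exact_mod_cast hh.ne'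
    have h2 : (Real.pi : ℂ) ≠ 0 := by exact_mod_cast Real.pi_ne_zero
    push_cast
    field_simp
    ring
  · simp

/-- The factor $\prod_i\bar d_id_i$ raises every exponent by one; this is the source of $(k+1)!$ in
place of $k!$. -/
theorem normSq_prod_mul_eq_monomial (N : ℕ) (j : Fin N) (k l : ℕ) (d : Fin N → ℂ) :
    ((‖∏ i, d i‖ ^ 2 : ℝ) : ℂ) * (conj (d j) ^ k * d j ^ l) =
      ∏ i, (conj (d i) ^ (1 + (Pi.single j k : Fin N → ℕ) i) *
        d i ^ (1 + (Pi.single j l : Fin N → ℕ) i)) := by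
  have hp : ∀ (z : Fin N → ℂ) (m : ℕ), ∏ i, z i ^ (Pi.single j m : Fin N → ℕ) i = z j ^ m := by
    intro z m
    rw [Finset.prod_eq_single j] <;> simp +contextual
  simp only [pow_add, pow_one, Finset.prod_mul_distrib]
  rw [hp (fun i => conj (d i)), hp d, ← map_prod, Complex.ofReal_pow, ← Complex.conj_mul']
  ring

theorem integrable_normSq_prod_mul_gaussC (N : ℕ) (h : Planck) (j : Fin N) (k l : ℕ) :
    Integrable (fun d : Fin N → ℂ => ((‖∏ i, d i‖ ^ 2 : ℝ) : ℂ) * (conj (d j) ^ k * d j ^ l))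
      (gaussC N h) := by
  simp only [normSq_prod_mul_eq_monomial]
  exact integrable_monomial_gaussC N h _ _

/-- When $k=l$, each of the $N-1$ coordinates other than $j$ contributes $h$, and the $j$-th
contributes $h^{k+1}(k+1)!$. What matters later is that the value does not depend on $j$. -/
theorem integral_normSq_prod_mul_gaussC (N : ℕ) (h : Planck) (j : Fin N) (k l : ℕ) :
    ∫ d : Fin N → ℂ, ((‖∏ i, d i‖ ^ 2 : ℝ) : ℂ) * (conj (d j) ^ k * d j ^ l) ∂(gaussC N h) =
      if k = l then ((h : ℝ) : ℂ) ^ (N + k) * (k + 1).factorial else 0 := by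
  simp only [normSq_prod_mul_eq_monomial]
  rw [integral_monomial_gaussC]
  split_ifs with hkl
  · subst hkl
    simp only [if_true, Finset.prod_mul_distrib, Finset.prod_pow_eq_pow_sum, Finset.sum_add_distrib,
      Finset.sum_pi_single']
    congr 1
    · simp
    · rw [Finset.prod_eq_single j] <;> simp +contextual [add_comm]
  · exact Finset.prod_eq_zero (Finset.mem_univ j) (by simp [hkl])

/-! ### Spectral coordinates on the normal matrices -/

/-- Since $(U^*DU)^m=U^*D^mU$, the pairing is diagonal in the coordinates of $Uv$ and $Uw$. -/
theorem inner_conjDiag_pow (N : ℕ) (p : Matrix.unitaryGroup (Fin N) ℂ × (Fin N → ℂ)) (k l : ℕ)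
    (v w : CVec N) :
    inner ℂ (WithLp.toLp 2 (((conjDiag N p : Mat N) ^ k).mulVec v) : CVec N)
      (WithLp.toLp 2 (((conjDiag N p : Mat N) ^ l).mulVec w)) =
    ∑ j, (conj (p.2 j) ^ k * p.2 j ^ l) *
      (conj ((p.1 : Mat N).mulVec v j) * (p.1 : Mat N).mulVec w j) := by
  have hU : (p.1 : Mat N) * (p.1 : Mat N).conjTranspose = 1 := Matrix.mem_unitaryGroup_iff.1 p.1.2
  have hU' : (p.1 : Mat N).conjTranspose * (p.1 : Mat N) = 1 := Matrix.mem_unitaryGroup_iff'.1 p.1.2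
  have hpow : ∀ m : ℕ, (conjDiag N p : Mat N) ^ m =
      (p.1 : Mat N).conjTranspose * Matrix.diagonal (p.2 ^ m) * (p.1 : Mat N) := by
    intro m
    induction m with
    | zero => simp [hU', Matrix.diagonal_one']
    | succ m ih =>
      rw [pow_succ, ih, pow_succ, show p.2 ^ m * p.2 = fun i => (p.2 ^ m) i * p.2 i from rfl,
        ← Matrix.diagonal_mul_diagonal]
      change _ * ((p.1 : Mat N).conjTranspose * Matrix.diagonal p.2 * (p.1 : Mat N)) = _
      calc _ = (p.1 : Mat N).conjTranspose * Matrix.diagonal (p.2 ^ m) *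
            ((p.1 : Mat N) * (p.1 : Mat N).conjTranspose) * Matrix.diagonal p.2 * (p.1 : Mat N) := by
            simp only [Matrix.mul_assoc]
        _ = _ := by rw [hU]; simp only [Matrix.mul_assoc, Matrix.mul_one]
  rw [EuclideanSpace.inner_toLp_toLp, hpow, hpow, dotProduct_comm, Matrix.star_mulVec,
    ← Matrix.dotProduct_mulVec, Matrix.mulVec_mulVec]
  simp only [Matrix.conjTranspose_mul, Matrix.conjTranspose_conjTranspose]
  have e2 : ((p.1 : Mat N).conjTranspose * ((Matrix.diagonal (p.2 ^ k)).conjTranspose *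
      (p.1 : Mat N))) * ((p.1 : Mat N).conjTranspose * Matrix.diagonal (p.2 ^ l) * (p.1 : Mat N)) =
      (p.1 : Mat N).conjTranspose * (((Matrix.diagonal (p.2 ^ k)).conjTranspose *
        Matrix.diagonal (p.2 ^ l)) * (p.1 : Mat N)) := by
    calc _ = (p.1 : Mat N).conjTranspose * (Matrix.diagonal (p.2 ^ k)).conjTranspose *
            ((p.1 : Mat N) * (p.1 : Mat N).conjTranspose) * Matrix.diagonal (p.2 ^ l) *
              (p.1 : Mat N) := by
            simp only [Matrix.mul_assoc]
        _ = _ := by rw [hU]; simp only [Matrix.mul_assoc, Matrix.mul_one]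
  rw [e2, ← Matrix.mulVec_mulVec, Matrix.dotProduct_mulVec, ← Matrix.star_mulVec,
    ← Matrix.mulVec_mulVec, Matrix.diagonal_conjTranspose, Matrix.diagonal_mul_diagonal]
  simp only [dotProduct, Matrix.mulVec_diagonal]
  refine Finset.sum_congr rfl fun j _ => ?_
  simp
  ring

theorem sum_conj_unitary_mulVec (N : ℕ) (U : Matrix.unitaryGroup (Fin N) ℂ) (v w : CVec N) :
    ∑ j, conj ((U : Mat N).mulVec v j) * (U : Mat N).mulVec w j = inner ℂ v w := by
  have hU' : (U : Mat N).conjTranspose * (U : Mat N) = 1 := Matrix.mem_unitaryGroup_iff'.1 U.2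
  change star ((U : Mat N).mulVec v) ⬝ᵥ (U : Mat N).mulVec w = _
  rw [Matrix.star_mulVec, ← Matrix.dotProduct_mulVec, Matrix.mulVec_mulVec, hU',
    Matrix.one_mulVec, dotProduct_comm]
  rfl

theorem det_conjDiag (N : ℕ) (p : Matrix.unitaryGroup (Fin N) ℂ × (Fin N → ℂ)) :
    (conjDiag N p : Mat N).det = ∏ i, p.2 i := by
  have hU : (p.1 : Mat N) * (p.1 : Mat N).conjTranspose = 1 := Matrix.mem_unitaryGroup_iff.1 p.1.2
  change ((p.1 : Mat N).conjTranspose * Matrix.diagonal p.2 * (p.1 : Mat N)).det = _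
  rw [Matrix.mul_assoc, Matrix.det_mul_comm, Matrix.mul_assoc, hU, Matrix.mul_one,
    Matrix.det_diagonal]

instance (N : ℕ) : IsProbabilityMeasure (haarU N) := by
  unfold haarU
  constructor
  exact Measure.haarMeasure_self (K₀ := ⊤)

instance (N : ℕ) (h : Planck) : SFinite (gaussC N h) := by unfold gaussC; infer_instance

/-! ### Growth bounds and moments on $\Omega_N$ -/

section
open scoped Matrix.Norms.L2Operator

theorem norm_det_le {N : ℕ} (A : Mat N) : ‖A.det‖ ≤ N.factorial * ‖A‖ ^ N := by
  have hent : ∀ i j, (NormedField.toAbsoluteValue ℂ) (A i j) ≤ ‖A‖ := by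
    intro i j
    have h1 := Matrix.l2_opNorm_mulVec A (EuclideanSpace.single j 1)
    have h2 := PiLp.norm_apply_le (WithLp.toLp 2 (A.mulVec (EuclideanSpace.single j (1 : ℂ)))
      : CVec N) i
    simp at h1 h2
    exact h2.trans h1
  refine (Matrix.det_le hent).trans_eq ?_
  simp

/-- A polynomial factor costs one unit in the exponent, $\|Y\|^m\le m!\,e^{\|Y\|}$, and exponentials
of any linear rate are integrable. -/
theorem integrable_of_norm_le (N : ℕ) (h : Planck) {E : Type*} [NormedAddCommGroup E]
    {f : NormalMat N → E} (hf : AEStronglyMeasurable f (mu N h)) (C B : ℝ) (m : ℕ) (hC : 0 ≤ C)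
    (hB : 0 ≤ B)
    (hb : ∀ Y : NormalMat N, ‖f Y‖ ≤ C * ‖(Y : Mat N)‖ ^ m * Real.exp (B * ‖(Y : Mat N)‖)) :
    Integrable f (mu N h) := by
  refine ((integrable_exp_norm N h (B + 1) (by positivity)).const_mul (C * m.factorial)).mono' hf
    (Eventually.of_forall fun Y => (hb Y).trans ?_)
  have h1 := Real.pow_div_factorial_le_exp ‖(Y : Mat N)‖ (norm_nonneg _) m
  rw [div_le_iff₀ (by positivity)] at h1
  calc _ ≤ C * (Real.exp ‖(Y : Mat N)‖ * m.factorial) * Real.exp (B * ‖(Y : Mat N)‖) := by gcongr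
    _ = _ := by rw [add_mul, one_mul, Real.exp_add]; ring

theorem continuous_pow_mulVec {N : ℕ} (k : ℕ) (v : CVec N) :
    Continuous fun Y : NormalMat N => (WithLp.toLp 2 (((Y : Mat N) ^ k).mulVec v) : CVec N) := by
  fun_prop

theorem continuous_norm_det_sq {N : ℕ} :
    Continuous fun Y : NormalMat N => ((‖(Y : Mat N).det‖ ^ 2 : ℝ) : ℂ) := by
  fun_prop

theorem integrable_det_inner_pow (N : ℕ) (h : Planck) (k l : ℕ) (v w : CVec N) :
    Integrable (fun Y : NormalMat N => ((‖(Y : Mat N).det‖ ^ 2 : ℝ) : ℂ) *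
      inner ℂ (WithLp.toLp 2 (((Y : Mat N) ^ k).mulVec v) : CVec N)
        (WithLp.toLp 2 (((Y : Mat N) ^ l).mulVec w))) (mu N h) := by
  refine integrable_of_norm_le N h (continuous_norm_det_sq.mul
    ((continuous_pow_mulVec k v).inner (continuous_pow_mulVec l w))).aestronglyMeasurable
    ((N.factorial : ℝ) ^ 2 * ‖v‖ * ‖w‖) 0 (N * 2 + k + l) (by positivity) le_rfl fun Y => ?_
  rw [norm_mul, Complex.norm_real, Real.norm_of_nonneg (by positivity), zero_mul, Real.exp_zero,
    mul_one]
  calc _ ≤ (N.factorial * ‖(Y : Mat N)‖ ^ N) ^ 2 *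
        ((‖(Y : Mat N)‖ ^ k * ‖v‖) * (‖(Y : Mat N)‖ ^ l * ‖w‖)) := by
        gcongr
        · exact norm_det_le _
        · refine (norm_inner_le_norm _ _).trans ?_
          gcongr
          · exact norm_pow_le_l2 _ _ _
          · exact norm_pow_le_l2 _ _ _
    _ = _ := by rw [mul_pow, ← pow_mul, pow_add, pow_add]; ring

/-- For fixed $U$ the inner Gaussian integral is already independent of $U$, so integrating over the
probability measure `haarU` changes nothing. -/
theorem integral_det_inner_pow (N : ℕ) (h : Planck) (k l : ℕ) (v w : CVec N) :
    ∫ Y : NormalMat N, ((‖(Y : Mat N).det‖ ^ 2 : ℝ) : ℂ) *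
      inner ℂ (WithLp.toLp 2 (((Y : Mat N) ^ k).mulVec v) : CVec N)
        (WithLp.toLp 2 (((Y : Mat N) ^ l).mulVec w)) ∂(mu N h) =
      (if k = l then ((h : ℝ) : ℂ) ^ (N + k) * (k + 1).factorial else 0) * inner ℂ v w := by
  have hi := integrable_det_inner_pow N h k l v w
  unfold mu at hi ⊢
  rw [integrable_map_measure hi.1 (continuous_conjDiag N).measurable.aemeasurable] at hi
  rw [integral_map (continuous_conjDiag N).measurable.aemeasurable
    (show AEStronglyMeasurable (fun Y : NormalMat N => _ * inner ℂ _ _) _ from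
      (continuous_norm_det_sq.mul ((continuous_pow_mulVec k v).inner
        (continuous_pow_mulVec l w))).aestronglyMeasurable)]
  refine (integral_prod _ hi).trans ?_
  simp only [Function.comp_apply]
  have hin : ∀ U : Matrix.unitaryGroup (Fin N) ℂ, ∫ d : Fin N → ℂ,
      ((‖(conjDiag N (U, d) : Mat N).det‖ ^ 2 : ℝ) : ℂ) *
      inner ℂ (WithLp.toLp 2 (((conjDiag N (U, d) : Mat N) ^ k).mulVec v) : CVec N)
        (WithLp.toLp 2 (((conjDiag N (U, d) : Mat N) ^ l).mulVec w)) ∂(gaussC N h) =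
      (if k = l then ((h : ℝ) : ℂ) ^ (N + k) * (k + 1).factorial else 0) * inner ℂ v w := by
    intro U
    simp only [inner_conjDiag_pow, det_conjDiag, Finset.mul_sum, ← mul_assoc]
    -- Expanding $\langle v,w\rangle$ as $\langle Uv,Uw\rangle$ makes both sides sums over $j$, to
    -- be matched term by term.
    simp only [mul_assoc _ (conj _ ^ k) _, ← sum_conj_unitary_mulVec N U v w]
    rw [integral_finsetSum _ fun j _ =>
      ((integrable_normSq_prod_mul_gaussC N h j k l).mul_const _).mul_const _, Finset.mul_sum]
    refine Finset.sum_congr rfl fun j _ => ?_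
    rw [integral_mul_const, integral_mul_const, integral_normSq_prod_mul_gaussC, mul_assoc]
  simp only [hin]
  simp

/-! ### The Toeplitz operator on kernel functions -/

theorem symMul_detSymbol {N : ℕ} (f : NormalMat N → CVec N) (Y : NormalMat N) :
    symMul (detSymbol N) f Y = ((‖(Y : Mat N).det‖ ^ 2 : ℝ) : ℂ) • f Y := by
  rw [symMul, detSymbol, Matrix.smul_mulVec, Matrix.one_mulVec, WithLp.toLp_smul]

theorem memLp_symMul_detSymbol_kernelFun (N : ℕ) (h : Planck) (X : NormalMat N) (χ : CVec N) :
    MemLp (symMul (detSymbol N) (kernelFun N h X χ)) 2 (mu N h) := by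
  have hh := h.2
  have hm : AEStronglyMeasurable (symMul (detSymbol N) (kernelFun N h X χ)) (mu N h) :=
    (continuous_norm_det_sq.aestronglyMeasurable.smul (aesm_kernelFun N h X χ)).congr
      (Eventually.of_forall fun Y => (symMul_detSymbol _ Y).symm)
  rw [memLp_two_iff_integrable_sq_norm hm]
  refine integrable_of_norm_le N h (hm.norm.pow 2) (((N.factorial : ℝ) ^ 2 * ‖χ‖) ^ 2)
    (2 * (‖(X : Mat N).conjTranspose‖ / h)) (N * 4) (by positivity) (by positivity) fun Y => ?_
  rw [symMul_detSymbol, norm_smul, Complex.norm_real, Real.norm_of_nonneg (by positivity),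
    Real.norm_of_nonneg (by positivity)]
  calc _ ≤ ((N.factorial * ‖(Y : Mat N)‖ ^ N) ^ 2 * kernelBound N h X χ Y) ^ 2 := by
        gcongr
        · exact norm_det_le _
        · exact norm_kernelFun_le N h X χ Y
    _ = _ := by
        rw [kernelBound, mul_assoc 2, two_mul (_ / _ * _), Real.exp_add, pow_mul]
        ring

theorem kernelVec_mem_toeplitzDomain (N : ℕ) (h : Planck) (X : NormalMat N) (χ : CVec N) :
    kernelVec N h X χ ∈ (toeplitz N h (detSymbol N)).domain := by
  refine (memLp_congr_ae ?_).2 (memLp_symMul_detSymbol_kernelFun N h X χ)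
  filter_upwards [(memLp_kernelFun N h X χ).coeFn_toLp] with Y hY
  rw [symMul_detSymbol, symMul_detSymbol]
  exact congrArg _ hY

/-- The projection drops out because the left-hand vector already lies in $\mathcal H_h$. -/
theorem inner_kernelVec_toeplitz (N : ℕ) (h : Planck) (X : NormalMat N) (χ χ' : CVec N)
    (hd : kernelVec N h X χ' ∈ (toeplitz N h (detSymbol N)).domain) :
    inner ℂ (kernelVec N h X χ) (toeplitz N h (detSymbol N) ⟨kernelVec N h X χ', hd⟩) =
      ∫ Y : NormalMat N, ((‖(Y : Mat N).det‖ ^ 2 : ℝ) : ℂ) *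
        inner ℂ (kernelFun N h X χ Y) (kernelFun N h X χ' Y) ∂(mu N h) := by
  change inner ℂ (kernelVec N h X χ) ((Hspace N h).orthogonalProjectionOnto
    (mulSymbol N h (detSymbol N) ⟨kernelVec N h X χ', hd⟩)) = _
  rw [Submodule.inner_orthogonalProjectionOnto_eq_of_mem_left, L2.inner_def]
  refine integral_congr_ae ?_
  filter_upwards [(memLp_kernelFun N h X χ).coeFn_toLp, (memLp_kernelFun N h X χ').coeFn_toLp,
    (memLp_symMul (φ := detSymbol N) ⟨kernelVec N h X χ', hd⟩).coeFn_toLp]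
    with Y h1 h2 h3
  change inner ℂ ((memLp_kernelFun N h X χ).toLp _ Y)
    ((memLp_symMul (φ := detSymbol N) ⟨kernelVec N h X χ', hd⟩).toLp _ Y) = _
  rw [h3, h1, symMul_detSymbol, inner_smul_right]
  change _ * inner ℂ _ ((memLp_kernelFun N h X χ').toLp _ Y) = _
  rw [h2]

/-- Orthogonality kills the terms off the diagonal; on it,
$(k!\,h^k)^{-2}h^{N+k}(k+1)!=h^N(k+1)/(k!\,h^k)$. -/
theorem integral_det_inner_partial (N : ℕ) (h : Planck) (X : NormalMat N) (χ χ' : CVec N) (n : ℕ) :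
    ∫ Y : NormalMat N, ((‖(Y : Mat N).det‖ ^ 2 : ℝ) : ℂ) *
      inner ℂ (∑ k ∈ Finset.range n, kernelTerm N h X χ k Y)
        (∑ k ∈ Finset.range n, kernelTerm N h X χ' k Y) ∂(mu N h) =
    ∑ k ∈ Finset.range n, (((h : ℝ) : ℂ) ^ N * ((k + 1 : ℂ) / (k.factorial * ((h : ℝ) : ℂ) ^ k))) *
      inner ℂ (WithLp.toLp 2 (((X : Mat N).conjTranspose ^ k).mulVec χ) : CVec N)
        (WithLp.toLp 2 (((X : Mat N).conjTranspose ^ k).mulVec χ')) := by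
  have h1 : ((h : ℝ) : ℂ) ≠ 0 := by exact_mod_cast h.2.ne'
  simp only [sum_inner, inner_sum, Finset.mul_sum]
  have hi : ∀ k l, Integrable (fun Y : NormalMat N => ((‖(Y : Mat N).det‖ ^ 2 : ℝ) : ℂ) *
      inner ℂ (kernelTerm N h X χ k Y) (kernelTerm N h X χ' l Y)) (mu N h) := fun k l =>
    integrable_det_inner_pow N h k l (WithLp.toLp 2 _) (WithLp.toLp 2 _)
  rw [integral_finsetSum _ fun l _ => integrable_finsetSum _ fun k _ => hi k l]
  refine Finset.sum_congr rfl fun k hk => ?_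
  rw [integral_finsetSum _ fun l _ => hi l k]
  have hc : ∀ l, ∫ Y : NormalMat N, ((‖(Y : Mat N).det‖ ^ 2 : ℝ) : ℂ) *
      inner ℂ (kernelTerm N h X χ l Y) (kernelTerm N h X χ' k Y) ∂(mu N h) = _ := fun l =>
    integral_det_inner_pow N h l k
      (WithLp.toLp 2 ((((l.factorial : ℂ) * ((h : ℝ) : ℂ) ^ l)⁻¹ •
        ((X : Mat N).conjTranspose ^ l).mulVec χ)))
      (WithLp.toLp 2 ((((k.factorial : ℂ) * ((h : ℝ) : ℂ) ^ k)⁻¹ •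
        ((X : Mat N).conjTranspose ^ k).mulVec χ')))
  simp only [hc, ite_mul, zero_mul]
  rw [Finset.sum_ite_eq', if_pos hk, WithLp.toLp_smul, WithLp.toLp_smul, inner_smul_left,
    inner_smul_right, ← mul_assoc, ← mul_assoc]
  congr 1
  have h2 : (k.factorial : ℂ) ≠ 0 := by exact_mod_cast k.factorial_ne_zero
  simp only [map_inv₀, map_mul, map_pow, Complex.conj_ofReal, map_natCast]
  rw [Nat.factorial_succ, pow_add]
  push_cast
  field_simp

/-- Dominated convergence: `kernelBound` controls all partial sums of the kernel series uniformly,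
and its products remain integrable against $|\det Y|^2$. -/
theorem tendsto_partial_inner_kernelVec_toeplitz (N : ℕ) (h : Planck) (X : NormalMat N) (χ χ' : CVec N) :
    Tendsto (fun n => ∑ k ∈ Finset.range n,
      (((h : ℝ) : ℂ) ^ N * ((k + 1 : ℂ) / (k.factorial * ((h : ℝ) : ℂ) ^ k))) *
      inner ℂ (WithLp.toLp 2 (((X : Mat N).conjTranspose ^ k).mulVec χ) : CVec N)
        (WithLp.toLp 2 (((X : Mat N).conjTranspose ^ k).mulVec χ'))) atTop
      (𝓝 (∫ Y : NormalMat N, ((‖(Y : Mat N).det‖ ^ 2 : ℝ) : ℂ) *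
        inner ℂ (kernelFun N h X χ Y) (kernelFun N h X χ' Y) ∂(mu N h))) := by
  have hh := h.2
  simp only [← integral_det_inner_partial]
  have hcb : ∀ χ : CVec N, Continuous (kernelBound N h X χ) := fun χ => by
    unfold kernelBound; fun_prop
  refine tendsto_integral_of_dominated_convergence (fun Y : NormalMat N => ‖(Y : Mat N).det‖ ^ 2 *
    (kernelBound N h X χ Y * kernelBound N h X χ' Y)) (fun n => ?_) ?_ (fun n => ?_) ?_
  · exact continuous_norm_det_sq.aestronglyMeasurable.mul
      ((memLp_partial N h X χ n).1.inner (memLp_partial N h X χ' n).1)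
  · refine integrable_of_norm_le N h (Continuous.aestronglyMeasurable (.mul (by fun_prop)
      ((hcb χ).mul (hcb χ')))) ((N.factorial : ℝ) ^ 2 * ‖χ‖ * ‖χ'‖)
      (2 * (‖(X : Mat N).conjTranspose‖ / h)) (N * 2) (by positivity) (by positivity) fun Y => ?_
    have hp : ∀ χ, 0 ≤ kernelBound N h X χ Y := fun χ => by unfold kernelBound; positivity
    rw [Real.norm_of_nonneg (mul_nonneg (by positivity) (mul_nonneg (hp _) (hp _)))]
    calc _ ≤ (N.factorial * ‖(Y : Mat N)‖ ^ N) ^ 2 *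
          (kernelBound N h X χ Y * kernelBound N h X χ' Y) :=
          mul_le_mul_of_nonneg_right (pow_le_pow_left₀ (norm_nonneg _) (norm_det_le _) 2)
            (mul_nonneg (hp _) (hp _))
      _ = _ := by
          rw [kernelBound, kernelBound, mul_assoc 2, two_mul (_ / _ * _), Real.exp_add, pow_mul]
          ring
  · refine Eventually.of_forall fun Y => ?_
    rw [norm_mul, Complex.norm_real, Real.norm_of_nonneg (by positivity)]
    refine mul_le_mul_of_nonneg_left ((norm_inner_le_norm _ _).trans ?_) (by positivity)
    exact mul_le_mul (norm_partial_le N h X χ n Y) (norm_partial_le N h X χ' n Y) (norm_nonneg _)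
      ((norm_nonneg _).trans (norm_partial_le N h X χ n Y))
  · exact Eventually.of_forall fun Y => ((hasSum_kernelTerm N h X χ Y).tendsto_sum_nat.inner
      (hasSum_kernelTerm N h X χ' Y).tendsto_sum_nat).const_mul _

/-! ### Summing the series: $K_h(X,X)$ and $W(X)$ as functions of $XX^*/h$ -/

/-- The rescaled square `X X* / h`. -/
def scaledSq {N : ℕ} (h : Planck) (X : Mat N) : Mat N :=
  ((h : ℝ) : ℂ)⁻¹ • (X * X.conjTranspose)

/-- Normality enters here: $(XX^*)^k=X^kX^{*k}$ because $X$ and $X^*$ commute. -/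
theorem scaledSq_pow {N : ℕ} (h : Planck) (X : NormalMat N) (k : ℕ) :
    scaledSq h (X : Mat N) ^ k =
      (((h : ℝ) : ℂ) ^ k)⁻¹ • ((X : Mat N) ^ k * (X : Mat N).conjTranspose ^ k) := by
  have hc : Commute (X : Mat N) (X : Mat N).conjTranspose := X.2.symm
  rw [scaledSq, smul_pow, hc.mul_pow, inv_pow]

theorem kernel_self_eq_exp {N : ℕ} (h : Planck) (X : NormalMat N) :
    kernel N h (X : Mat N) X = NormedSpace.exp (scaledSq h (X : Mat N)) := by
  rw [← (NormedSpace.exp_series_hasSum_exp' (𝕂 := ℂ) (scaledSq h (X : Mat N))).tsum_eq, kernel]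
  refine tsum_congr fun k => ?_
  rw [scaledSq_pow, smul_smul, mul_inv]

theorem hasSum_add_one_mul_pow_div_factorial {𝔸 : Type*} [NormedRing 𝔸] [NormedAlgebra ℂ 𝔸]
    [CompleteSpace 𝔸] (a : 𝔸) :
    HasSum (fun k : ℕ => ((k + 1 : ℂ) / k.factorial) • a ^ k) ((1 + a) * NormedSpace.exp a) := by
  have he := NormedSpace.exp_series_hasSum_exp' (𝕂 := ℂ) a
  have h1 : HasSum (fun k : ℕ => ((k : ℂ) / k.factorial) • a ^ k) (a * NormedSpace.exp a) := by
    -- The term $k=0$ vanishes, so the series may be shifted by one, and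
    -- $\frac{k+1}{(k+1)!}a^{k+1}=a\cdot\frac{a^k}{k!}$.
    rw [← add_zero (a * _), ← show ∑ i ∈ Finset.range 1, (((i : ℂ) / i.factorial) • a ^ i) = 0 by
      simp, ← hasSum_nat_add_iff]
    have e : ∀ k : ℕ, (((k + 1 : ℕ) : ℂ) / (k + 1).factorial) • a ^ (k + 1) =
        a * ((k.factorial : ℂ)⁻¹ • a ^ k) := fun k => by
      have h2 : (k.factorial : ℂ) ≠ 0 := by exact_mod_cast k.factorial_ne_zero
      have h3 : (k + 1 : ℂ) ≠ 0 := by exact_mod_cast k.succ_ne_zero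
      rw [mul_smul_comm, ← pow_succ', Nat.factorial_succ]
      congr 1
      push_cast
      field_simp
    simp only [e]
    exact he.mul_left a
  have e : ∀ k : ℕ, ((k + 1 : ℂ) / k.factorial) • a ^ k =
      (k.factorial : ℂ)⁻¹ • a ^ k + ((k : ℂ) / k.factorial) • a ^ k := fun k => by
    rw [← add_smul]
    congr 1
    ring
  rw [add_mul, one_mul]
  simp only [e]
  exact he.add h1

theorem berezin_weight (N : ℕ) (h : Planck) (X : NormalMat N) (a b : Fin N)
    (hd : kernelVec N h X (EuclideanSpace.single b 1) ∈ (toeplitz N h (detSymbol N)).domain) :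
    inner ℂ (kernelVec N h X (EuclideanSpace.single a 1))
      (toeplitz N h (detSymbol N) ⟨kernelVec N h X (EuclideanSpace.single b 1), hd⟩) =
    (((h : ℝ) : ℂ) ^ N • ((1 + scaledSq h (X : Mat N)) * kernel N h (X : Mat N) X)) a b := by
  rw [inner_kernelVec_toeplitz]
  refine tendsto_nhds_unique (tendsto_partial_inner_kernelVec_toeplitz N h X _ _) ?_
  have hs := ((hasSum_add_one_mul_pow_div_factorial (scaledSq h (X : Mat N))).const_smul
    (((h : ℝ) : ℂ) ^ N)).tendsto_sum_nat
  rw [kernel_self_eq_exp]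
  refine (((continuous_id.matrix_elem a b).tendsto _).comp hs).congr fun n => ?_
  simp only [Function.comp_apply, id]
  rw [Matrix.sum_apply]
  refine Finset.sum_congr rfl fun k _ => ?_
  rw [scaledSq_pow, EuclideanSpace.inner_toLp_toLp, dotProduct_comm, Matrix.star_mulVec,
    ← Matrix.dotProduct_mulVec, Matrix.mulVec_mulVec, Matrix.conjTranspose_pow,
    Matrix.conjTranspose_conjTranspose]
  have e : star (WithLp.ofLp (EuclideanSpace.single a (1 : ℂ) : CVec N)) = Pi.single a 1 := by
    ext i; simp [Pi.single_apply]
  rw [e, single_one_dotProduct]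
  simp
  ring

end

/-! ### Closed form of the Berezin transform -/

section
open scoped MatrixOrder

theorem berezin_toeplitz_detSymbol (N : ℕ) (hN : 1 ≤ N) (h : Planck) (X : NormalMat N)
    (hdom : ∀ X χ, kernelVec N h X χ ∈ (toeplitz N h (detSymbol N)).domain) :
    berezin (toeplitz N h (detSymbol N)) hdom X =
      ((h : ℝ) : ℂ) ^ (N - 1) • ((X : Mat N).conjTranspose * X) + ((h : ℝ) : ℂ) ^ N • (1 : Mat N) := by
  have h1 : ((h : ℝ) : ℂ) ≠ 0 := by exact_mod_cast h.2.ne'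
  set A := scaledSq h (X : Mat N) with hA
  set K := kernel N h (X : Mat N) X with hK
  have hsa : IsSelfAdjoint A := by
    rw [hA, scaledSq, IsSelfAdjoint, star_smul, Matrix.star_eq_conjTranspose]
    simp
  -- As the exponential of a self-adjoint matrix, $K$ is nonnegative and invertible; this makes the
  -- exponent laws available for its negative real powers.
  have hpos : IsStrictlyPositive K := by
    open scoped Matrix.Norms.L2Operator in
    rw [hK, kernel_self_eq_exp]
    exact IsStrictlyPositive.iff_of_unital.2 ⟨hsa.exp_nonneg, Matrix.isUnit_exp _⟩
  have hcomm : Commute K A := by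
    rw [hK, kernel_self_eq_exp]
    open scoped Matrix.Norms.L2Operator in
    exact (Commute.refl A).exp_left
  -- $K^{-1/2}$ comes from the functional calculus of $K$, so it commutes with whatever commutes
  -- with $K$.
  have hcomm2 : Commute (K ^ (-1 / 2 : ℝ)) (1 + A) := by
    rw [CFC.rpow_def]
    exact ((Commute.one_right K).add_right hcomm).cfc_nnreal _
  have hKK : K ^ (-1 / 2 : ℝ) * K * K ^ (-1 / 2 : ℝ) = 1 := by
    have e : K ^ (-1 / 2 : ℝ) * K = K ^ (1 / 2 : ℝ) := by
      calc _ = K ^ (-1 / 2 : ℝ) * K ^ (1 : ℝ) := by rw [CFC.rpow_one K hpos.nonneg]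
        _ = _ := by rw [← CFC.rpow_add hpos.isUnit]; norm_num
    rw [e, neg_div]
    exact CFC.rpow_mul_rpow_neg _ hpos
  have hW : berezin (toeplitz N h (detSymbol N)) hdom X =
      K ^ (-1 / 2 : ℝ) * (((h : ℝ) : ℂ) ^ N • ((1 + A) * K)) * K ^ (-1 / 2 : ℝ) := by
    unfold berezin
    congr 2
    ext a b
    exact berezin_weight N h X a b _
  rw [hW, Matrix.mul_smul, Matrix.smul_mul, ← mul_assoc, hcomm2.eq, mul_assoc (1 + A),
    mul_assoc (1 + A), hKK, mul_one, smul_add, hA, scaledSq, smul_smul, X.2, add_comm]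
  congr 2
  -- With $N=n+1$ the truncated exponent $N-1$ becomes $n$, and $h^N\cdot h^{-1}=h^{N-1}$ is a field
  -- identity.
  obtain ⟨n, rfl⟩ := Nat.exists_eq_add_of_le' hN
  rw [pow_succ]
  field_simp
  simp
end

end NormalBerezin

end

/-! ### Expansion, limit and counterexample -/

theorem mainTheorem9 (N : ℕ) (hN : 2 ≤ N) :
    ∃ hdom : ∀ (h : NormalBerezin.Planck) (X : NormalBerezin.NormalMat N)
        (χ : NormalBerezin.CVec N), NormalBerezin.kernelVec N h X χ ∈
          (NormalBerezin.toeplitz N h (NormalBerezin.detSymbol N)).domain,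
      (∀ (X : NormalBerezin.NormalMat N) (M : ℕ) (a b : Fin N),
        (fun h : NormalBerezin.Planck =>
          (NormalBerezin.berezin
              (NormalBerezin.toeplitz N h (NormalBerezin.detSymbol N)) (hdom h) X -
            (((h : ℝ) : ℂ) ^ (N - 1) • ((X : NormalBerezin.Mat N).conjTranspose * X) +
              ((h : ℝ) : ℂ) ^ N • (1 : NormalBerezin.Mat N))) a b)
          =O[NormalBerezin.toZero] fun h => (h : ℝ) ^ M) ∧
      (∀ X : NormalBerezin.NormalMat N,
        Tendsto (fun h : NormalBerezin.Planck => NormalBerezin.berezin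
            (NormalBerezin.toeplitz N h (NormalBerezin.detSymbol N)) (hdom h) X)
          NormalBerezin.toZero (𝓝 0)) ∧
      NormalBerezin.detSymbol N ≠ 0 ∧
      ¬ ∀ X : NormalBerezin.NormalMat N,
        Tendsto (fun h : NormalBerezin.Planck => NormalBerezin.berezin
            (NormalBerezin.toeplitz N h (NormalBerezin.detSymbol N)) (hdom h) X)
          NormalBerezin.toZero (𝓝 (NormalBerezin.detSymbol N X)) := by
  have hdom := NormalBerezin.kernelVec_mem_toeplitzDomain N
  have hB := fun h X => NormalBerezin.berezin_toeplitz_detSymbol N (by omega) h X (hdom h)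
  have hlim : ∀ X : NormalBerezin.NormalMat N,
      Tendsto (fun h : NormalBerezin.Planck => NormalBerezin.berezin
          (NormalBerezin.toeplitz N h (NormalBerezin.detSymbol N)) (hdom h) X)
        NormalBerezin.toZero (𝓝 0) := by
    intro X
    simp only [hB]
    have h0 : Tendsto (fun h : NormalBerezin.Planck => ((h : ℝ) : ℂ)) NormalBerezin.toZero
        (𝓝 0) := by
      have := (Complex.continuous_ofReal.tendsto 0).comp
        (tendsto_comap (f := (Subtype.val : NormalBerezin.Planck → ℝ)) (x := 𝓝 0))
      rwa [Complex.ofReal_zero] at this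
    have := ((h0.pow (N - 1)).smul_const ((X : NormalBerezin.Mat N).conjTranspose * X)).add
      ((h0.pow N).smul_const (1 : NormalBerezin.Mat N))
    -- Here $N\ge2$ is essential: for $N=1$ the term $h^{N-1}X^*X$ would not tend to zero.
    simpa [zero_pow (show N - 1 ≠ 0 by omega), zero_pow (show N ≠ 0 by omega)] using this
  -- Uniqueness of limits along `toZero` needs the filter to be nontrivial: every neighbourhood of
  -- $0$ contains some $\varepsilon/2>0$.
  have hne : NormalBerezin.toZero.NeBot := by
    rw [NormalBerezin.toZero, comap_neBot_iff]
    intro t ht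
    obtain ⟨ε, hε, hb⟩ := Metric.mem_nhds_iff.1 ht
    refine ⟨⟨ε / 2, half_pos hε⟩, hb ?_⟩
    rw [Metric.mem_ball, dist_zero_right, Real.norm_of_nonneg (half_pos hε).le]
    exact half_lt_self hε
  -- The identity matrix serves both remaining claims: $\phi(I)=I\ne0$ shows that $\phi\ne0$ and
  -- contradicts the limit $0$ there.
  let I : NormalBerezin.NormalMat N := ⟨1, by simp⟩
  have hI : NormalBerezin.detSymbol N I ≠ 0 := by
    intro h0
    have := congrFun (congrFun h0 ⟨0, by omega⟩) ⟨0, by omega⟩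
    simp [NormalBerezin.detSymbol, I] at this
  refine ⟨hdom, fun X M a b => ?_, hlim, fun h0 => hI (congrFun h0 I), fun hall => ?_⟩
  · simp only [hB, sub_self, Matrix.zero_apply]
    exact isBigO_zero _ _
  · exact hI (tendsto_nhds_unique (hall I) (hlim I))
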